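/- For $m\in\mathbb N_0$ let $L_m(y)=\frac{\sqrt{2m+1}}{2^m\,m!}\frac{\mathrm d^m}{\mathrm dy^m}\big[(y^2-1)^m\big]$ be the orthonormal Legendre polynomials on $[-1,1]$ with respect to the uniform density $\rho_0=\tfrac12$. For $k\in\mathbb N_0$ let $K^k$ be the infinite matrix with entries $$[K^k]_{l+1,m+1}=\int_{-1}^{1}y^k L_l(y)L_m(y)\rho_0(y)\,\mathrm dy,\qquad l,m\in\mathbb N_0.$$ For $k,l,m\in\mathbb N_0$, with $g=(k+l+m)/2$, let the squared Wigner 3j-symbol with zero magnetic quantum numbers be $$\begin{pmatrix}k&l&m\\0&0&0\end{pmatrix}^2=\frac{(2g-2k)!\,(2g-2l)!\,(2g-2m)!}{(2g+1)!}\left[\frac{g!}{(g-k)!\,(g-l)!\,(g-m)!}\right]^2$$ if $k+l+m$ is even and $|k-l|\le m\le k+l$, and $0$ otherwise. Then for all $k,l,m\in\mathbb N_0$ $$[K^k]_{l+1,m+1}=\sum_{n=0}^{k}l_n^k\,L(l,m,n),$$ where, for $0\le n\le k$, $$l_n^k=\binom kn\,n!\,\sqrt{2n+1}\,\frac{(k-n-1)!!}{(k+n+1)!!}\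 \text{ if } k-n \text{ is even},\qquad l_n^k=0\ \text{ if } k-n\text{ is odd}$$ (with $(-1)!!=1$), and $$L(l,m,n)=\sqrt{(2l+1)(2m+1)(2n+1)}\begin{pmatrix}l&m&n\\0&0&0\end{pmatrix}^2.$$ Consequently, $K^k$ is a symmetric $(2k+1)$-diagonal matrix, that is, $[K^k]_{l+1,m+1}=0$ whenever $|l-m|>k$, and its odd diagonals ($l-m$ odd) vanish when $k$ is even and its even diagonals ($l-m$ even) vanish when $k$ is odd. All other entries, i.e. those with $|l-m|\le k$ and $k+l+m$ even, are nonzero. -/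

import Mathlib

namespace LegendreMoment

/-- The `m`-th orthonormal Legendre polynomial by Rodrigues' formula,
`L_m(y) = √(2m+1) / (2^m m!) * d^m/dy^m [(y^2 - 1)^m]`. -/
noncomputable def legendre (m : ℕ) : Polynomial ℝ :=
  Polynomial.C (Real.sqrt (2 * (m : ℝ) + 1) / (2 ^ m * (m.factorial : ℝ))) *
    Polynomial.derivative^[m] ((Polynomial.X ^ 2 - 1) ^ m)

/-- The uniform probability density `ρ₀` on `[-1, 1]`; it is only evaluated there. -/
noncomputable def density (_y : ℝ) : ℝ := 1 / 2

/-- The moment matrix `K^k`, an infinite matrix. Rows and columns are numbered from `0`, by the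
degrees `l` and `m`; counted from `1` this is the entry with indices `l + 1` and `m + 1`. -/
noncomputable def momentMatrix (k : ℕ) : Matrix ℕ ℕ ℝ :=
  Matrix.of fun l m =>
    ∫ y in (-1 : ℝ)..1, y ^ k * (legendre l).eval y * (legendre m).eval y * density y

/-- The square of the Wigner 3j-symbol `(k l m; 0 0 0)`, where `g = (k + l + m) / 2`. In the first
branch the division defining `g` is exact and no subtraction truncates. -/
noncomputable def wignerSq (k l m : ℕ) : ℝ :=
  if Even (k + l + m) ∧ |(k : ℤ) - (l : ℤ)| ≤ (m : ℤ) ∧ m ≤ k + l then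
    let g := (k + l + m) / 2
    (((2 * g - 2 * k).factorial : ℝ) * ((2 * g - 2 * l).factorial : ℝ) *
        ((2 * g - 2 * m).factorial : ℝ) / ((2 * g + 1).factorial : ℝ)) *
      ((g.factorial : ℝ) /
        (((g - k).factorial : ℝ) * ((g - l).factorial : ℝ) * ((g - m).factorial : ℝ))) ^ 2
  else 0

/-- `L(l, m, n) = √((2l+1)(2m+1)(2n+1)) * (l m n; 0 0 0)^2`. -/
noncomputable def tripleCoeff (l m n : ℕ) : ℝ :=
  Real.sqrt ((2 * (l : ℝ) + 1) * (2 * (m : ℝ) + 1) * (2 * (n : ℝ) + 1)) * wignerSq l m n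

/-- The coefficient `l_n^k`, for `0 ≤ n ≤ k`. For `n = k` the truncated subtraction gives
`0‼ = 1`, which is the usual value of `(-1)‼`. -/
noncomputable def inversionCoeff (k n : ℕ) : ℝ :=
  if Even (k - n) then
    (k.choose n : ℝ) * (n.factorial : ℝ) * Real.sqrt (2 * (n : ℝ) + 1) *
      (((k - n - 1).doubleFactorial : ℝ) / ((k + n + 1).doubleFactorial : ℝ))
  else 0

end LegendreMoment

/-!
Write `⟨p⟩` for the mean of a polynomial `p` over `[-1, 1]` and `Pₙ` for the Legendre polynomials
with `Pₙ(1) = 1`, so that `Lₙ = √(2n+1) Pₙ`. The sum formula splits into two facts: the expansion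
of the monomial `yᵏ` in Legendre polynomials (`X_pow_eq_sum_legendreP`), and Adams' formula
`⟨Pₗ Pₘ Pₙ⟩ = (l m n; 0 0 0)²` (`uniformMean_legendreP_mul_mul`). Both rest on Bonnet's recursion
`(2n+1) y Pₙ = (n+1) Pₙ₊₁ + n Pₙ₋₁` (`bonnet`), derived from Rodrigues' formula by differentiating
`(y² - 1)ⁿ⁺¹` in two ways.

The expansion of `yᵏ` follows by induction on `k`, since multiplication by `y` acts on the
coefficients by the recursion `monomialCoeff_succ`.

For Adams' formula, Bonnet's recursion turns `⟨(y Pₗ) Pₘ Pₙ⟩ = ⟨Pₗ (y Pₘ) Pₙ⟩` into a recursion in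
`l` and `m` that determines everything from the row `l = 0` (`ExchangeRecursion.unique`). The
squared Wigner symbol satisfies the same recursion (`exchangeRecursion_wignerSq`). To see this it
is written, with `a = g - k`, `b = g - l`, `c = g - m`, as `A(a) A(b) A(c) / (A(g) (2g + 1))`, where
`A(j) = (2j)! / (j!)²` is extended by zero to negative integers; the relation
`(j+1) A(j+1) = 2 (2j+1) A(j)` then holds for all integers `j`, and the boundary of the triangle
condition needs no separate treatment. On the row `l = 0` the formula is the orthogonality of the
Legendre polynomials, which is the case `n = 0` of the same uniqueness argument, started from
`⟨Pₘ⟩ = 0` for `m > 0`.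

The vanishing pattern is that of the terms of the sum. All terms are nonnegative, and if
`|l - m| ≤ k` and `k + l + m` is even, then the term `n = |l - m|` is positive.
-/

namespace LegendreMoment

open Polynomial

/-! ### Legendre polynomials in the classical normalization -/

/-- The Legendre polynomial `Pₙ` with the classical normalization `Pₙ(1) = 1`, given by Rodrigues'
formula. -/
noncomputable def legendreP (n : ℕ) : ℝ[X] :=
  C (1 / (2 ^ n * (n.factorial : ℝ))) * derivative^[n] ((X ^ 2 - 1) ^ n)

lemma legendre_eq (n : ℕ) : legendre n = C (Real.sqrt (2 * (n : ℝ) + 1)) * legendreP n := by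
  rw [legendre, legendreP, ← mul_assoc, ← C_mul, mul_one_div]

lemma legendreP_zero : legendreP 0 = 1 := by simp [legendreP]

lemma legendreP_one : legendreP 1 = X := by
  have h : C (1 / 2 : ℝ) * C 2 = 1 := by rw [← C_mul]; norm_num
  simp only [legendreP, Function.iterate_one, pow_one, derivative_sub, derivative_X_pow,
    derivative_one, Nat.factorial_one, Nat.cast_one, mul_one, Nat.cast_ofNat, Nat.add_one_sub_one,
    sub_zero]
  linear_combination X * h

lemma iterate_derivative_X_mul (n : ℕ) (p : ℝ[X]) :
    derivative^[n + 1] (X * p) =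
      X * derivative^[n + 1] p + C ((n : ℝ) + 1) * derivative^[n] p := by
  induction n with
  | zero => simp; ring
  | succ n ih =>
    rw [Function.iterate_succ_apply', ih]
    simp only [derivative_add, derivative_mul, derivative_X, derivative_C, one_mul, zero_mul,
      zero_add, ← Function.iterate_succ_apply' (⇑derivative)]
    push_cast
    simp only [C_add, C_1]
    ring

lemma derivative_sq_sub_one_pow (n : ℕ) :
    derivative ((X ^ 2 - 1 : ℝ[X]) ^ (n + 1)) =
      C (2 * ((n : ℝ) + 1)) * (X * (X ^ 2 - 1) ^ n) := by
  simp [derivative_pow, C_mul, C_add]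
  ring

lemma derivative_derivative_sq_sub_one_pow (n : ℕ) :
    derivative (derivative ((X ^ 2 - 1 : ℝ[X]) ^ (n + 2))) =
      C (2 * ((n : ℝ) + 2) * (2 * n + 3)) * (X ^ 2 - 1) ^ (n + 1) +
        C (4 * ((n : ℝ) + 2) * (n + 1)) * (X ^ 2 - 1) ^ n := by
  rw [derivative_sq_sub_one_pow, derivative_C_mul, derivative_mul, derivative_sq_sub_one_pow]
  simp only [derivative_X, one_mul]
  push_cast
  simp only [C_mul, C_add, C_1, C_ofNat, pow_succ]
  ring

/-- Bonnet's recursion for the unnormalized polynomials `dⁿ/dyⁿ (y² - 1)ⁿ`. The two ways of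
differentiating `(y² - 1)ⁿ⁺²`, once or twice before expanding, both produce the term
`dⁿ/dyⁿ (y² - 1)ⁿ⁺¹`, which is then eliminated. -/
lemma rodrigues_recurrence (n : ℕ) :
    derivative^[n + 2] ((X ^ 2 - 1 : ℝ[X]) ^ (n + 2)) =
      C (2 * (2 * (n : ℝ) + 3)) * (X * derivative^[n + 1] ((X ^ 2 - 1) ^ (n + 1))) -
        C (4 * ((n : ℝ) + 1) ^ 2) * derivative^[n] ((X ^ 2 - 1) ^ n) := by
  have h₁ : derivative^[n + 2] ((X ^ 2 - 1 : ℝ[X]) ^ (n + 2)) =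
      C (2 * ((n : ℝ) + 2)) * (X * derivative^[n + 1] ((X ^ 2 - 1) ^ (n + 1)) +
        C ((n : ℝ) + 1) * derivative^[n] ((X ^ 2 - 1) ^ (n + 1))) := by
    rw [Function.iterate_succ_apply, derivative_sq_sub_one_pow, iterate_derivative_C_mul,
      iterate_derivative_X_mul]
    push_cast
    ring_nf
  have h₂ : derivative^[n + 2] ((X ^ 2 - 1 : ℝ[X]) ^ (n + 2)) =
      C (2 * ((n : ℝ) + 2) * (2 * n + 3)) * derivative^[n] ((X ^ 2 - 1) ^ (n + 1)) +
        C (4 * ((n : ℝ) + 2) * (n + 1)) * derivative^[n] ((X ^ 2 - 1) ^ n) := by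
    rw [Function.iterate_succ_apply, Function.iterate_succ_apply,
      derivative_derivative_sq_sub_one_pow, iterate_map_add, iterate_derivative_C_mul,
      iterate_derivative_C_mul]
  have hn : C ((n : ℝ) + 2) ≠ 0 := by
    rw [Ne, C_eq_zero]; positivity
  refine mul_left_cancel₀ hn ?_
  generalize derivative^[n + 2] ((X ^ 2 - 1 : ℝ[X]) ^ (n + 2)) = A at *
  simp only [C_mul, C_add, C_1, C_ofNat, C_pow] at *
  linear_combination (2 * C (n : ℝ) + 3) * h₁ - (C (n : ℝ) + 1) * h₂

/-- Bonnet's recursion `(2n+1) y Pₙ = (n+1) Pₙ₊₁ + n Pₙ₋₁`. At `n = 0` the truncated index `n - 1`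
is harmless, its coefficient being zero. -/
lemma bonnet (n : ℕ) :
    C (2 * (n : ℝ) + 1) * (X * legendreP n) =
      C ((n : ℝ) + 1) * legendreP (n + 1) + C (n : ℝ) * legendreP (n - 1) := by
  cases n with
  | zero => simp [legendreP_zero, legendreP_one]
  | succ n =>
    -- The leading factors `1 / (2ⁿ n!)` of two consecutive polynomials have ratio `2 (n + 1)`.
    have hc (i : ℕ) : C (1 / (2 ^ i * (i.factorial : ℝ))) =
        2 * (C (i : ℝ) + 1) * C (1 / (2 ^ (i + 1) * ((i + 1).factorial : ℝ))) := by
      rw [← C_ofNat, ← C_1, ← C_add, ← C_mul, ← C_mul]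
      congr 1
      rw [Nat.factorial_succ]
      push_cast
      field_simp
      ring
    have h₀ := hc n
    have h₁ := hc (n + 1)
    simp only [legendreP, Nat.add_sub_cancel, add_assoc, Nat.reduceAdd, rodrigues_recurrence]
      at h₀ h₁ ⊢
    generalize C (1 / (2 ^ n * (n.factorial : ℝ))) = c₀ at *
    generalize C (1 / (2 ^ (n + 1) * ((n + 1).factorial : ℝ))) = c₁ at *
    generalize C (1 / (2 ^ (n + 2) * ((n + 2).factorial : ℝ))) = c₂ at *
    generalize derivative^[n + 1] ((X ^ 2 - 1 : ℝ[X]) ^ (n + 1)) = A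
    generalize derivative^[n] ((X ^ 2 - 1 : ℝ[X]) ^ n) = B
    push_cast at *
    simp only [C_mul, C_add, C_1, C_ofNat, C_pow] at *
    generalize C (n : ℝ) = N at *
    linear_combination (2 * N + 3) * X * A * h₁ - (N + 1) * B * h₀ -
      2 * (N + 1) ^ 2 * B * h₁

/-! ### The mean over `[-1, 1]` -/

/-- The mean of a polynomial for the uniform probability density on `[-1, 1]`. -/
noncomputable def uniformMean : ℝ[X] →ₗ[ℝ] ℝ where
  toFun p := (∫ y in (-1 : ℝ)..1, p.eval y) / 2
  map_add' p q := by
    simp only [eval_add]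
    rw [intervalIntegral.integral_add (p.continuous.intervalIntegrable _ _)
      (q.continuous.intervalIntegrable _ _), add_div]
  map_smul' c p := by
    simp [mul_div_assoc]

lemma uniformMean_C_mul (c : ℝ) (p : ℝ[X]) : uniformMean (C c * p) = c * uniformMean p := by
  rw [← smul_eq_C_mul, map_smul, smul_eq_mul]

lemma uniformMean_one : uniformMean 1 = 1 := by
  simp [uniformMean]

lemma uniformMean_derivative (p : ℝ[X]) :
    uniformMean (derivative p) = (p.eval 1 - p.eval (-1)) / 2 := by
  simp only [uniformMean, LinearMap.coe_mk, AddHom.coe_mk]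
  rw [intervalIntegral.integral_eq_sub_of_hasDerivAt (fun x _ => p.hasDerivAt x)
    (p.derivative.continuous.intervalIntegrable _ _)]

lemma uniformMean_legendreP_succ (n : ℕ) : uniformMean (legendreP (n + 1)) = 0 := by
  rw [legendreP, uniformMean_C_mul, Function.iterate_succ_apply', uniformMean_derivative]
  have h := pow_sub_dvd_iterate_derivative_pow (X ^ 2 - 1 : ℝ[X]) (n + 1) n
  rw [Nat.add_sub_cancel_left, pow_one] at h
  obtain ⟨q, hq⟩ := h
  simp [hq]

lemma momentMatrix_eq_uniformMean (k l m : ℕ) :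
    momentMatrix k l m = Real.sqrt (2 * (l : ℝ) + 1) * Real.sqrt (2 * (m : ℝ) + 1) *
      uniformMean (X ^ k * (legendreP l * legendreP m)) := by
  simp only [momentMatrix, Matrix.of_apply, density, uniformMean, LinearMap.coe_mk, AddHom.coe_mk,
    legendre_eq, eval_mul, eval_C, eval_pow, eval_X]
  rw [← intervalIntegral.integral_div, ← intervalIntegral.integral_const_mul]
  congr 1
  ext y
  ring

/-! ### The exchange recursion -/

/-- A recursion in two indices which determines `T` from its row `l = 0`. With truncated
subtraction, the terms of index `-1` carry the coefficient zero. For `T l m` the mean of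
`Pₗ Pₘ q` it expresses that `y Pₗ · Pₘ q = Pₗ · y Pₘ q`. -/
def ExchangeRecursion (T : ℕ → ℕ → ℝ) : Prop :=
  ∀ l m : ℕ, (2 * (m : ℝ) + 1) * (((l : ℝ) + 1) * T (l + 1) m + l * T (l - 1) m) =
    (2 * (l : ℝ) + 1) * (((m : ℝ) + 1) * T l (m + 1) + m * T l (m - 1))

lemma ExchangeRecursion.unique {S T : ℕ → ℕ → ℝ} (hS : ExchangeRecursion S)
    (hT : ExchangeRecursion T) (h₀ : ∀ m, S 0 m = T 0 m) (l m : ℕ) : S l m = T l m := by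
  induction l using Nat.strong_induction_on generalizing m with
  | _ l ih =>
    cases l with
    | zero => exact h₀ m
    | succ l =>
      have hs := hS l m
      have ht := hT l m
      rw [ih l (by omega), ih l (by omega), ih (l - 1) (by omega)] at hs
      have hl : (l : ℝ) + 1 ≠ 0 := by positivity
      have hm : 2 * (m : ℝ) + 1 ≠ 0 := by positivity
      refine mul_left_cancel₀ hm (mul_left_cancel₀ hl ?_)
      linear_combination hs - ht

lemma exchangeRecursion_uniformMean (q : ℝ[X]) :
    ExchangeRecursion fun l m => uniformMean (legendreP l * legendreP m * q) := by
  intro l m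
  simp only [← uniformMean_C_mul, ← map_add]
  have hl := bonnet l
  have hm := bonnet m
  refine congrArg uniformMean ?_
  generalize C (2 * (l : ℝ) + 1) = a at *
  generalize C (2 * (m : ℝ) + 1) = b at *
  generalize C ((l : ℝ) + 1) = a' at *
  generalize C ((m : ℝ) + 1) = b' at *
  linear_combination a * legendreP l * q * hm - b * legendreP m * q * hl

/-! ### The squared Wigner 3j-symbol -/

/-- The central binomial coefficient `(2j)! / (j!)²`, extended by zero to negative integers. -/
noncomputable def intCentralBinom (j : ℤ) : ℝ :=
  if 0 ≤ j then (j.toNat.centralBinom : ℝ) else 0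

lemma intCentralBinom_natCast (j : ℕ) : intCentralBinom j = j.centralBinom := by
  simp [intCentralBinom]

lemma intCentralBinom_of_neg {j : ℤ} (hj : j < 0) : intCentralBinom j = 0 := by
  simp [intCentralBinom, hj]

/-- The recursion of the central binomial coefficients. With the extension by zero it holds for
every integer, both sides vanishing at `j = -1`. -/
lemma intCentralBinom_succ (j : ℤ) :
    ((j : ℝ) + 1) * intCentralBinom (j + 1) = 2 * (2 * (j : ℝ) + 1) * intCentralBinom j := by
  rcases lt_trichotomy j (-1) with h | rfl | h
  · rw [intCentralBinom_of_neg (by omega), intCentralBinom_of_neg (by omega)]; simp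
  · simp [intCentralBinom_of_neg]
  · lift j to ℕ using by omega
    have := Nat.succ_mul_centralBinom_succ j
    rw [intCentralBinom_natCast, show (j : ℤ) + 1 = ((j + 1 : ℕ) : ℤ) by simp,
      intCentralBinom_natCast]
    exact_mod_cast this

/-- The squared Wigner symbol as a function of `a = g - k`, `b = g - l`, `c = g - m`, whose sum is
`g`. It vanishes as soon as one of the arguments is negative. -/
noncomputable def wignerAux (a b c : ℤ) : ℝ :=
  intCentralBinom a * intCentralBinom b * intCentralBinom c /
    (intCentralBinom (a + b + c) * (2 * ((a : ℝ) + b + c) + 1))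

lemma two_mul_intCast_add_one_ne_zero (a : ℤ) : 2 * (a : ℝ) + 1 ≠ 0 := by
  exact_mod_cast (by omega : 2 * a + 1 ≠ 0)

/-- The exchange recursion in the variables of `wignerAux`, at `l = b + c` and `m = a + c`. -/
lemma wignerAux_exchange (a b c : ℤ) (h : 0 ≤ a + b + c) :
    (2 * ((a : ℝ) + c) + 1) * (((b : ℝ) + c + 1) * wignerAux a (b + 1) c +
        ((b : ℝ) + c) * wignerAux (a + 1) b (c - 1)) =
      (2 * ((b : ℝ) + c) + 1) * (((a : ℝ) + c + 1) * wignerAux (a + 1) b c +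
        ((a : ℝ) + c) * wignerAux a (b + 1) (c - 1)) := by
  have ha := intCentralBinom_succ a
  have hb := intCentralBinom_succ b
  have hc := intCentralBinom_succ (c - 1)
  have hs := intCentralBinom_succ (a + b + c)
  have ha0 := two_mul_intCast_add_one_ne_zero a
  have hb0 := two_mul_intCast_add_one_ne_zero b
  have hc0 : 2 * (c : ℝ) - 1 ≠ 0 := by exact_mod_cast (by omega : 2 * c - 1 ≠ 0)
  have hs' : (0 : ℝ) ≤ (a : ℝ) + b + c := by exact_mod_cast h
  have hsp : 0 < intCentralBinom (a + b + c) := by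
    rw [intCentralBinom, if_pos h]
    exact_mod_cast Nat.centralBinom_pos _
  simp only [wignerAux, show a + (b + 1) + c = a + b + c + 1 by ring,
    show a + 1 + b + c = a + b + c + 1 by ring,
    show a + (b + 1) + (c - 1) = a + b + c by ring,
    show a + 1 + b + (c - 1) = a + b + c by ring]
  rw [sub_add_cancel] at hc
  push_cast at hc hs ⊢
  -- The numerator factors are expressed by those with the larger argument, since `2j + 1` never
  -- vanishes on the integers but `j + 1` does at `j = -1`. In the denominator `a + b + c ≥ 0`.
  have ea : intCentralBinom a = ((a : ℝ) + 1) * intCentralBinom (a + 1) / (2 * (2 * a + 1)) := by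
    rw [eq_div_iff (by simpa using ha0)]; linarith
  have eb : intCentralBinom b = ((b : ℝ) + 1) * intCentralBinom (b + 1) / (2 * (2 * b + 1)) := by
    rw [eq_div_iff (by simpa using hb0)]; linarith
  have ec : intCentralBinom (c - 1) = (c : ℝ) * intCentralBinom c / (2 * (2 * c - 1)) := by
    rw [eq_div_iff (by simpa using hc0)]; linarith
  have es : intCentralBinom (a + b + c + 1) =
      2 * (2 * ((a : ℝ) + b + c) + 1) * intCentralBinom (a + b + c) / ((a : ℝ) + b + c + 1) := by
    rw [eq_div_iff (by positivity)]; linarith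
  rw [es, ea, eb, ec]
  generalize intCentralBinom (a + 1) = A
  generalize intCentralBinom (b + 1) = B
  generalize intCentralBinom c = D
  generalize intCentralBinom (a + b + c) = S at *
  generalize (a : ℝ) = a at ha0 hs' ⊢
  generalize (b : ℝ) = b at hb0 hs' ⊢
  generalize (c : ℝ) = c at hc0 hs' ⊢
  have hS : S ≠ 0 := hsp.ne'
  rw [show a + (b + 1) + c = a + b + c + 1 by ring,
    show a + 1 + b + c = a + b + c + 1 by ring,
    show a + (b + 1) + (c - 1) = a + b + c by ring,
    show a + 1 + b + (c - 1) = a + b + c by ring]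
  obtain ⟨p, hp⟩ : ∃ p, p = 2 * a + 1 := ⟨_, rfl⟩
  obtain ⟨q, hq⟩ : ∃ q, q = 2 * b + 1 := ⟨_, rfl⟩
  obtain ⟨r, hr⟩ : ∃ r, r = 2 * c - 1 := ⟨_, rfl⟩
  obtain ⟨t, ht⟩ : ∃ t, t = p + q + r := ⟨_, rfl⟩
  obtain rfl : a = (p - 1) / 2 := by linarith
  obtain rfl : b = (q - 1) / 2 := by linarith
  obtain rfl : c = (r + 1) / 2 := by linarith
  rw [← hp] at ha0 ⊢
  rw [← hq] at hb0 ⊢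
  rw [← hr] at hc0 ⊢
  rw [show (p - 1) / 2 + (q - 1) / 2 + (r + 1) / 2 = (t - 1) / 2 by rw [ht]; ring] at hs' ⊢
  have ht₀ : t ≠ 0 := by linarith
  have ht₁ : t + 1 ≠ 0 := by linarith
  have ht₂ : t + 2 ≠ 0 := by linarith
  rw [show 2 * ((t - 1) / 2) + 1 = t by ring, show (t - 1) / 2 + 1 = (t + 1) / 2 by ring,
    show 2 * ((t + 1) / 2) + 1 = t + 2 by ring]
  field_simp
  rw [ht]
  ring

/-- The squared Wigner symbol with integer arguments, extended by zero. -/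
noncomputable def wignerInt (k l m : ℤ) : ℝ :=
  if Even (k + l + m) then
    wignerAux ((k + l + m) / 2 - k) ((k + l + m) / 2 - l) ((k + l + m) / 2 - m)
  else 0

lemma wignerAux_eq_zero {a b c : ℤ} (h : a < 0 ∨ b < 0 ∨ c < 0) : wignerAux a b c = 0 := by
  rcases h with h | h | h <;> simp [wignerAux, intCentralBinom_of_neg h]

lemma wignerInt_of_eq {k l m a b c : ℤ} (hk : k = b + c) (hl : l = a + c) (hm : m = a + b) :
    wignerInt k l m = wignerAux a b c := by
  have h : k + l + m = 2 * (a + b + c) := by rw [hk, hl, hm]; ring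
  rw [wignerInt, h, if_pos (even_two_mul _), Int.mul_ediv_cancel_left _ two_ne_zero]
  congr 1 <;> omega

lemma wignerInt_of_odd {k l m : ℤ} (h : Odd (k + l + m)) : wignerInt k l m = 0 :=
  if_neg (Int.not_even_iff_odd.2 h)

lemma wignerAux_natCast (a b c : ℕ) : wignerAux a b c =
    ((2 * a).factorial : ℝ) * ((2 * b).factorial : ℝ) * ((2 * c).factorial : ℝ) /
      ((2 * (a + b + c) + 1).factorial : ℝ) *
      (((a + b + c).factorial : ℝ) /
        ((a.factorial : ℝ) * (b.factorial : ℝ) * (c.factorial : ℝ))) ^ 2 := by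
  have h (j : ℕ) : ((2 * j).factorial : ℝ) = j.centralBinom * (j.factorial : ℝ) ^ 2 := by
    have := Nat.choose_mul_factorial_mul_factorial (show j ≤ 2 * j by omega)
    rw [show 2 * j - j = j by omega] at this
    rw [← this, Nat.centralBinom]
    push_cast
    ring
  have h0 (j : ℕ) : (j.centralBinom : ℝ) ≠ 0 := by exact_mod_cast j.centralBinom_ne_zero
  have hS := h0 (a + b + c)
  rw [wignerAux, Nat.factorial_succ, Nat.cast_mul, h a, h b, h c, h (a + b + c),
    show (a : ℤ) + b + c = ((a + b + c : ℕ) : ℤ) by simp]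
  simp only [intCentralBinom_natCast]
  push_cast
  have : 2 * ((a : ℝ) + b + c) + 1 ≠ 0 := by positivity
  field_simp

lemma wignerSq_eq_wignerInt (k l m : ℕ) : wignerSq k l m = wignerInt k l m := by
  by_cases he : Even (k + l + m)
  · obtain ⟨g, hg⟩ := he
    have hz := wignerInt_of_eq (k := k) (l := l) (m := m) (a := g - k) (b := g - l) (c := g - m)
      (by omega) (by omega) (by omega)
    by_cases ht : k ≤ g ∧ l ≤ g ∧ m ≤ g
    · obtain ⟨hk, hl, hm⟩ := ht
      rw [wignerSq, if_pos ⟨⟨g, hg⟩, abs_le.2 (by omega), by omega⟩, hz]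
      simp only [show (k + l + m) / 2 = g by omega]
      rw [← Nat.cast_sub hk, ← Nat.cast_sub hl, ← Nat.cast_sub hm, wignerAux_natCast,
        show g - k + (g - l) + (g - m) = g by omega]
      simp only [Nat.mul_sub]
    · rw [wignerSq, if_neg, hz, wignerAux_eq_zero (by omega)]
      rw [abs_le]
      omega
  · rw [wignerSq, if_neg fun h => he h.1, wignerInt_of_odd]
    exact_mod_cast Nat.not_even_iff_odd.1 he

lemma wignerSq_nonneg (k l m : ℕ) : 0 ≤ wignerSq k l m := by
  rw [wignerSq]
  split_ifs <;> positivity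

lemma wignerSq_pos {k l m : ℕ} (he : Even (k + l + m)) (h₁ : |(k : ℤ) - l| ≤ m)
    (h₂ : m ≤ k + l) : 0 < wignerSq k l m := by
  rw [wignerSq, if_pos ⟨he, h₁, h₂⟩]
  positivity

lemma exchangeRecursion_wignerSq (n : ℕ) : ExchangeRecursion fun l m => wignerSq l m n := by
  intro l m
  simp only [wignerSq_eq_wignerInt]
  have hpred (x : ℕ) (f : ℤ → ℝ) : (x : ℝ) * f ((x - 1 : ℕ) : ℤ) = x * f ((x : ℤ) - 1) := by
    cases x <;> simp
  rw [hpred l (fun x => wignerInt x m n), hpred m (fun x => wignerInt l x n)]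
  push_cast
  rcases Int.even_or_odd ((l : ℤ) + m + n) with he | ho
  · rw [wignerInt_of_odd, wignerInt_of_odd, wignerInt_of_odd, wignerInt_of_odd]
    · simp
    all_goals
      rw [Int.odd_iff]
      rw [Int.even_iff] at he
      omega
  · -- Here `l = b + c`, `m = a + c` and `n = a + b + 1`.
    obtain ⟨s, hs⟩ := ho
    have h := wignerAux_exchange (s - l) (s - m) (l + m - s) (by omega)
    rw [wignerInt_of_eq (a := s - l) (b := s - m + 1) (c := l + m - s),
      wignerInt_of_eq (a := s - l + 1) (b := s - m) (c := l + m - s - 1),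
      wignerInt_of_eq (a := s - l + 1) (b := s - m) (c := l + m - s),
      wignerInt_of_eq (a := s - l) (b := s - m + 1) (c := l + m - s - 1)]
    · push_cast at h
      ring_nf at h ⊢
      exact h
    all_goals omega

lemma wignerSq_zero_left (m n : ℕ) :
    wignerSq 0 m n = if m = n then 1 / (2 * (m : ℝ) + 1) else 0 := by
  split_ifs with h
  · subst h
    have h0 : (m.centralBinom : ℝ) ≠ 0 := by exact_mod_cast m.centralBinom_ne_zero
    have h1 : intCentralBinom 0 = 1 := by simp [intCentralBinom]
    rw [wignerSq_eq_wignerInt, wignerInt_of_eq (a := m) (b := 0) (c := 0) (by simp) (by simp)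
      (by simp), wignerAux]
    simp only [add_zero, h1, intCentralBinom_natCast, Int.cast_natCast, Int.cast_zero, mul_one]
    field_simp
  · rw [wignerSq, if_neg]
    rw [abs_le]
    omega

lemma wignerInt_rotate (k l m : ℤ) : wignerInt k l m = wignerInt m k l := by
  rw [wignerInt, wignerInt, show m + k + l = k + l + m by ring]
  congr 1
  simp only [wignerAux]
  ring_nf

/-! ### The mean of three Legendre polynomials -/

lemma uniformMean_legendreP_mul (l m : ℕ) :
    uniformMean (legendreP l * legendreP m) = if l = m then 1 / (2 * (l : ℝ) + 1) else 0 := by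
  have h := (exchangeRecursion_uniformMean 1).unique (exchangeRecursion_wignerSq 0) ?_ l m
  · rw [mul_one] at h
    rw [h, ← wignerSq_zero_left, wignerSq_eq_wignerInt, wignerSq_eq_wignerInt, wignerInt_rotate]
  · intro m
    rw [wignerSq_zero_left, legendreP_zero, one_mul, mul_one]
    cases m with
    | zero => simp [legendreP_zero, uniformMean_one]
    | succ m => simp [uniformMean_legendreP_succ]

/-- Adams' formula: the mean of `Pₗ Pₘ Pₙ` is a squared Wigner symbol. Both sides satisfy the same
exchange recursion, and at `l = 0` the claim is the orthogonality of the Legendre polynomials. -/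
theorem uniformMean_legendreP_mul_mul (l m n : ℕ) :
    uniformMean (legendreP l * legendreP m * legendreP n) = wignerSq l m n := by
  refine (exchangeRecursion_uniformMean (legendreP n)).unique (exchangeRecursion_wignerSq n) ?_ l m
  intro m
  rw [wignerSq_zero_left, legendreP_zero, one_mul, uniformMean_legendreP_mul]

/-! ### Monomials in terms of Legendre polynomials -/

/-- The mean of `yᵏ Pₙ`, that is, `inversionCoeff k n` without the factor `√(2n+1)`. It is zero for
`n > k` because the binomial coefficient is. -/
noncomputable def monomialCoeff (k n : ℕ) : ℝ :=
  if Even (k - n) then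
    (k.choose n : ℝ) * (n.factorial : ℝ) *
      (((k - n - 1).doubleFactorial : ℝ) / ((k + n + 1).doubleFactorial : ℝ))
  else 0

lemma inversionCoeff_eq (k n : ℕ) :
    inversionCoeff k n = Real.sqrt (2 * (n : ℝ) + 1) * monomialCoeff k n := by
  simp only [inversionCoeff, monomialCoeff, mul_ite, mul_zero]
  congr 1
  ring

lemma monomialCoeff_of_lt {k n : ℕ} (h : k < n) : monomialCoeff k n = 0 := by
  simp [monomialCoeff, Nat.choose_eq_zero_of_lt h]

lemma monomialCoeff_of_odd {k n : ℕ} (h : Odd (k - n)) : monomialCoeff k n = 0 :=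
  if_neg (Nat.not_even_iff_odd.2 h)

lemma monomialCoeff_nonneg (k n : ℕ) : 0 ≤ monomialCoeff k n := by
  rw [monomialCoeff]
  split_ifs <;> positivity

lemma monomialCoeff_pos {k n : ℕ} (h : n ≤ k) (he : Even (k - n)) : 0 < monomialCoeff k n := by
  have := Nat.choose_pos h
  have := Nat.doubleFactorial_pos (k - n - 1)
  have := Nat.doubleFactorial_pos (k + n + 1)
  rw [monomialCoeff, if_pos he]
  positivity

lemma monomialCoeff_add_two_mul (n j : ℕ) : monomialCoeff (n + 2 * j) n =
    ((n + 2 * j).factorial : ℝ) /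
      (((2 * j).doubleFactorial : ℝ) * ((2 * n + 2 * j + 1).doubleFactorial : ℝ)) := by
  have hc : ((n + 2 * j).choose n : ℝ) * n.factorial * (2 * j).factorial =
      (n + 2 * j).factorial := by
    have := Nat.choose_mul_factorial_mul_factorial (show n ≤ n + 2 * j by omega)
    rw [Nat.add_sub_cancel_left] at this
    exact_mod_cast this
  have hd : ((2 * j).factorial : ℝ) =
      ((2 * j).doubleFactorial : ℝ) * ((2 * j - 1).doubleFactorial : ℝ) := by
    cases j with
    | zero => simp
    | succ j => exact_mod_cast Nat.factorial_eq_mul_doubleFactorial (2 * j + 1)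
  have h₁ : ((2 * j).doubleFactorial : ℝ) ≠ 0 := by
    exact_mod_cast (Nat.doubleFactorial_pos _).ne'
  have h₂ : ((2 * n + 2 * j + 1).doubleFactorial : ℝ) ≠ 0 := by
    exact_mod_cast (Nat.doubleFactorial_pos _).ne'
  rw [monomialCoeff, if_pos (by simp), Nat.add_sub_cancel_left, ← hc, hd,
    show n + 2 * j + n + 1 = 2 * n + 2 * j + 1 by ring]
  field_simp

/-- The recursion obtained by comparing the expansions of `yᵏ⁺¹` and `y · yᵏ`. -/
lemma monomialCoeff_succ (k n : ℕ) :
    (2 * (n : ℝ) + 1) * monomialCoeff (k + 1) n =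
      n * monomialCoeff k (n - 1) + ((n : ℝ) + 1) * monomialCoeff k (n + 1) := by
  rcases lt_or_ge (k + 1) n with h | h
  · rw [monomialCoeff_of_lt h, monomialCoeff_of_lt (by omega), monomialCoeff_of_lt (by omega)]
    simp
  rcases Nat.even_or_odd (k + 1 - n) with he | ho
  swap
  · have h₁ : (n : ℝ) * monomialCoeff k (n - 1) = 0 := by
      cases n with
      | zero => simp
      | succ n =>
        rw [monomialCoeff_of_odd, mul_zero]
        simpa using ho
    have h₂ : monomialCoeff k (n + 1) = 0 := by
      rcases lt_or_ge k (n + 1) with h' | h'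
      · exact monomialCoeff_of_lt h'
      · refine monomialCoeff_of_odd ?_
        rw [Nat.odd_iff] at ho ⊢
        omega
    rw [monomialCoeff_of_odd ho, h₁, h₂]
    simp
  obtain ⟨j, hj⟩ := he
  obtain hk : k + 1 = n + 2 * j := by omega
  have hp (i : ℕ) : (i.doubleFactorial : ℝ) ≠ 0 := by
    exact_mod_cast (Nat.doubleFactorial_pos i).ne'
  rw [hk, monomialCoeff_add_two_mul]
  -- The two terms on the right, written with the factorials of the left-hand side.
  have h₁ : (n : ℝ) * monomialCoeff k (n - 1) = n * (k.factorial : ℝ) * (2 * n + 2 * j + 1) /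
      (((2 * j).doubleFactorial : ℝ) * ((2 * n + 2 * j + 1).doubleFactorial : ℝ)) := by
    cases n with
    | zero => simp
    | succ n =>
      obtain rfl : k = n + 2 * j := by omega
      have hd : ((2 * (n + 1) + 2 * j + 1).doubleFactorial : ℝ) =
          (2 * (n + 1) + 2 * j + 1) * (2 * n + 2 * j + 1).doubleFactorial := by
        rw [show 2 * (n + 1) + 2 * j + 1 = 2 * n + 2 * j + 1 + 2 by ring,
          Nat.doubleFactorial_add_two]
        push_cast
        ring
      rw [Nat.add_sub_cancel, monomialCoeff_add_two_mul, hd]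
      have := hp (2 * j)
      have := hp (2 * n + 2 * j + 1)
      have : 2 * ((n : ℝ) + 1) + 2 * j + 1 ≠ 0 := by positivity
      push_cast
      field_simp
  have h₂ : ((n : ℝ) + 1) * monomialCoeff k (n + 1) = (n + 1) * (k.factorial : ℝ) * (2 * j) /
      (((2 * j).doubleFactorial : ℝ) * ((2 * n + 2 * j + 1).doubleFactorial : ℝ)) := by
    cases j with
    | zero =>
      rw [monomialCoeff_of_lt (by omega)]
      simp
    | succ j =>
      obtain rfl : k = n + 1 + 2 * j := by omega
      have hd : ((2 * (j + 1)).doubleFactorial : ℝ) =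
          2 * (j + 1) * (2 * j).doubleFactorial := by
        rw [show 2 * (j + 1) = 2 * j + 2 by ring, Nat.doubleFactorial_add_two]
        push_cast
        ring
      rw [monomialCoeff_add_two_mul, hd,
        show 2 * (n + 1) + 2 * j + 1 = 2 * n + 2 * (j + 1) + 1 by ring]
      have := hp (2 * j)
      have := hp (2 * n + 2 * (j + 1) + 1)
      push_cast
      field_simp
  rw [h₁, h₂, ← add_div, ← mul_div_assoc, ← hk, Nat.factorial_succ]
  congr 1
  have : (k : ℝ) + 1 = n + 2 * j := by exact_mod_cast hk
  push_cast
  rw [this]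
  ring

lemma X_pow_eq_sum_legendreP (k : ℕ) :
    (X : ℝ[X]) ^ k = ∑ n ∈ Finset.range (k + 1),
      C ((2 * (n : ℝ) + 1) * monomialCoeff k n) * legendreP n := by
  induction k with
  | zero => simp [legendreP_zero, monomialCoeff]
  | succ k ih =>
    have hstep (n : ℕ) : X * (C ((2 * (n : ℝ) + 1) * monomialCoeff k n) * legendreP n) =
        C (((n : ℝ) + 1) * monomialCoeff k n) * legendreP (n + 1) +
          C ((n : ℝ) * monomialCoeff k n) * legendreP (n - 1) := by
      simp only [C_mul]
      linear_combination C (monomialCoeff k n) * bonnet n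
    -- Shifting the index in both halves produces the two terms of `monomialCoeff_succ`.
    have hup : ∑ n ∈ Finset.range (k + 1),
        C (((n : ℝ) + 1) * monomialCoeff k n) * legendreP (n + 1) =
        ∑ n ∈ Finset.range (k + 2), C ((n : ℝ) * monomialCoeff k (n - 1)) * legendreP n := by
      rw [Finset.sum_range_succ' _ (k + 1)]
      simp
    have hdown : ∑ n ∈ Finset.range (k + 1),
        C ((n : ℝ) * monomialCoeff k n) * legendreP (n - 1) =
        ∑ n ∈ Finset.range (k + 2),
          C (((n : ℝ) + 1) * monomialCoeff k (n + 1)) * legendreP n := by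
      rw [Finset.sum_range_succ', Finset.sum_range_succ _ (k + 1), Finset.sum_range_succ _ k,
        monomialCoeff_of_lt (show k < k + 1 by omega),
        monomialCoeff_of_lt (show k < k + 1 + 1 by omega)]
      simp
    rw [pow_succ', ih, Finset.mul_sum, Finset.sum_congr rfl fun n _ => hstep n,
      Finset.sum_add_distrib, hup, hdown, ← Finset.sum_add_distrib]
    refine Finset.sum_congr rfl fun n _ => ?_
    rw [monomialCoeff_succ, ← add_mul, ← C_add]

/-! ### The moment matrix -/

lemma momentMatrix_eq_sum (k l m : ℕ) :
    momentMatrix k l m =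
      ∑ n ∈ Finset.range (k + 1), inversionCoeff k n * tripleCoeff l m n := by
  rw [momentMatrix_eq_uniformMean, X_pow_eq_sum_legendreP, Finset.sum_mul, map_sum, Finset.mul_sum]
  refine Finset.sum_congr rfl fun n _ => ?_
  rw [mul_assoc (C _), mul_comm (legendreP n), uniformMean_C_mul, uniformMean_legendreP_mul_mul,
    inversionCoeff_eq, tripleCoeff, Real.sqrt_mul (by positivity), Real.sqrt_mul (by positivity)]
  have h := Real.mul_self_sqrt (show 0 ≤ 2 * (n : ℝ) + 1 by positivity)
  linear_combination -(√(2 * (l : ℝ) + 1) * √(2 * (m : ℝ) + 1) * monomialCoeff k n *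
    wignerSq l m n) * h

lemma tripleCoeff_nonneg (l m n : ℕ) : 0 ≤ tripleCoeff l m n :=
  mul_nonneg (Real.sqrt_nonneg _) (wignerSq_nonneg l m n)

lemma inversionCoeff_nonneg (k n : ℕ) : 0 ≤ inversionCoeff k n := by
  rw [inversionCoeff_eq]
  exact mul_nonneg (Real.sqrt_nonneg _) (monomialCoeff_nonneg k n)

lemma momentMatrix_isSymm (k : ℕ) : (momentMatrix k).IsSymm := by
  refine Matrix.IsSymm.ext fun l m => ?_
  simp only [momentMatrix, Matrix.of_apply]
  congr 1
  ext y
  ring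

lemma momentMatrix_eq_zero_of_lt {k l m : ℕ} (h : (k : ℤ) < |(l : ℤ) - m|) :
    momentMatrix k l m = 0 := by
  rw [momentMatrix_eq_sum]
  refine Finset.sum_eq_zero fun n hn => ?_
  rw [Finset.mem_range] at hn
  rw [tripleCoeff, wignerSq, if_neg (fun h' => by omega), mul_zero, mul_zero]

lemma momentMatrix_eq_zero_of_odd {k l m : ℕ} (h : Odd (k + l + m)) :
    momentMatrix k l m = 0 := by
  rw [momentMatrix_eq_sum]
  refine Finset.sum_eq_zero fun n hn => ?_
  rw [Finset.mem_range] at hn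
  rw [Nat.odd_iff] at h
  by_cases he : Even (k - n)
  · rw [tripleCoeff, wignerSq, if_neg, mul_zero, mul_zero]
    rw [Nat.even_iff] at he ⊢
    omega
  · rw [inversionCoeff, if_neg he, zero_mul]

/-- No cancellation can occur: all terms of the sum are nonnegative, and the one with
`n = |l - m|` is positive. -/
lemma momentMatrix_pos {k l m : ℕ} (h : |(l : ℤ) - m| ≤ k) (he : Even (k + l + m)) :
    0 < momentMatrix k l m := by
  rw [momentMatrix_eq_sum]
  have hn : (((l : ℤ) - m).natAbs : ℤ) = |(l : ℤ) - m| := Int.natCast_natAbs _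
  generalize ((l : ℤ) - m).natAbs = n at hn
  rw [Nat.even_iff] at he
  have hcase := abs_choice ((l : ℤ) - m)
  refine Finset.sum_pos' (fun i _ =>
    mul_nonneg (inversionCoeff_nonneg k i) (tripleCoeff_nonneg l m i))
    ⟨n, Finset.mem_range.2 (by omega), mul_pos ?_ (mul_pos ?_ (wignerSq_pos ?_ hn.ge ?_))⟩
  · rw [inversionCoeff_eq]
    refine mul_pos (Real.sqrt_pos.2 (by positivity)) (monomialCoeff_pos (by omega) ?_)
    rw [Nat.even_iff]
    omega
  · exact Real.sqrt_pos.2 (by positivity)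
  · rw [Nat.even_iff]
    omega
  · omega

end LegendreMoment

theorem theorem3p1 (k : ℕ) :
    (∀ l m : ℕ, LegendreMoment.momentMatrix k l m =
      ∑ n ∈ Finset.range (k + 1),
        LegendreMoment.inversionCoeff k n * LegendreMoment.tripleCoeff l m n) ∧
    (LegendreMoment.momentMatrix k).IsSymm ∧
    (∀ l m : ℕ, (k : ℤ) < |(l : ℤ) - (m : ℤ)| → LegendreMoment.momentMatrix k l m = 0) ∧
    (Even k → ∀ l m : ℕ, Odd ((l : ℤ) - (m : ℤ)) → LegendreMoment.momentMatrix k l m = 0) ∧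
    (Odd k → ∀ l m : ℕ, Even ((l : ℤ) - (m : ℤ)) → LegendreMoment.momentMatrix k l m = 0) ∧
    (∀ l m : ℕ, |(l : ℤ) - (m : ℤ)| ≤ (k : ℤ) → Even (k + l + m) →
      LegendreMoment.momentMatrix k l m ≠ 0) := by
  refine ⟨LegendreMoment.momentMatrix_eq_sum k, LegendreMoment.momentMatrix_isSymm k,
    fun l m h => LegendreMoment.momentMatrix_eq_zero_of_lt h,
    fun hk l m h => LegendreMoment.momentMatrix_eq_zero_of_odd ?_,
    fun hk l m h => LegendreMoment.momentMatrix_eq_zero_of_odd ?_,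
    fun l m h he => (LegendreMoment.momentMatrix_pos h he).ne'⟩
  · rw [Nat.even_iff] at hk
    rw [Int.odd_iff] at h
    rw [Nat.odd_iff]
    omega
  · rw [Nat.odd_iff] at hk
    rw [Int.even_iff] at h
    rw [Nat.odd_iff]
    omega
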